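/- Let $\mathbb{N}_0=\{0,1,2,\dots\}$. For $c\in\mathbb{N}_0$ and a finite set $P\subset\mathbb{N}_0$, let $c+\langle P\rangle=\{c+\sum_{p\in P}a_p\,p : a_p\in\mathbb{N}_0\}$ be the $1$-dimensional linear set with constant $c$ and set of periods $P$. The containment problem for $1$-dimensional linear sets with a unary encoding of numbers is the following decision problem: given $c,c'\in\mathbb{N}_0$ and finite sets $P,P'\subset\mathbb{N}_0$ (each set presented as a list of its elements), with all numbers encoded in unary, decide whether $c+\langle P\rangle\subseteq c'+\langle P'\rangle$. **Theorem.** The containment problem for $1$-dimensional linear sets with a unary encoding of numbers is in $\mathrm{P}$. That is, the language of all strings $$1^{c},1^{p_1},\dots,1^{p_k};1^{c'},1^{p'_1},\dots,1^{p'_{l}}$$ over the three-letter alphabet $\{1,\ \text{comma},\ \text{semicolon}\}$, with $k,l\ge 0$, such that $c+\langle\{p_1,\dots,p_k\}\rangle\subseteq c'+\langle\{p'_1,\dots,p'_l\}\rangle$, is decided by a deterministic Turing machine whose running time is bounded by a polynomial in the length of the input string. -/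

import Mathlib

namespace LinearSetContainment

/-- The one-dimensional linear set `c + ⟨P⟩` with constant `c` and finite set of periods `P`,
where `⟨P⟩` consists of all combinations of the periods with coefficients in `ℕ`. -/
def linearSet (c : ℕ) (P : Finset ℕ) : Set ℕ :=
  {n | ∃ a : ℕ → ℕ, n = c + ∑ p ∈ P, a p * p}

/-- The input alphabet: a unary digit and two separators. -/
inductive Sym
  | tick
  | comma
  | semicolon
  deriving DecidableEq

instance : Fintype Sym where
  elems := {Sym.tick, Sym.comma, Sym.semicolon}
  complete x := by cases x <;> simp

/-- The unary code `1^c , 1^(p₁) , … , 1^(pₖ)` of a constant `c` and a list of periods. -/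
def encodeLinear (c : ℕ) : List ℕ → List Sym
  | [] => List.replicate c Sym.tick
  | p :: ps => List.replicate c Sym.tick ++ Sym.comma :: encodeLinear p ps

/-- The unary code of an instance `(c, P, c', P')` of the containment problem, the two finite sets
`P` and `P'` being given by lists of their elements (in any order, repetitions allowed). -/
def encodeInstance (c : ℕ) (P : List ℕ) (c' : ℕ) (P' : List ℕ) : List Sym :=
  encodeLinear c P ++ Sym.semicolon :: encodeLinear c' P'

/-- The containment problem for one-dimensional linear sets with unary encoding of numbers:
the set of all codes of instances `(c, P, c', P')` such that `c + ⟨P⟩ ⊆ c' + ⟨P'⟩`.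
A string that is not the code of an instance does not belong to it. -/
def unaryContainment : Language Sym :=
  {w | ∃ (c : ℕ) (P : List ℕ) (c' : ℕ) (P' : List ℕ),
    w = encodeInstance c P c' P' ∧ linearSet c P.toFinset ⊆ linearSet c' P'.toFinset}

open Classical in
/-- The complexity class P: there is a Turing machine (with finitely many stacks, each over a finite
alphabet) that, started on an arbitrary string `w` over the input alphabet, halts after a number of
steps that is at most a polynomial in the length of `w` and outputs the truth value of `w ∈ L`. -/
def InP {Γ : Type} [Fintype Γ] (L : Language Γ) : Prop :=
  ∃ M : Turing.TM2ComputableInPolyTime (id : List Γ → List Γ) Computability.encodeBool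
      (fun w => decide (w ∈ L)),
    ∀ k : M.tm.K, Finite (M.tm.Γ k)

end LinearSetContainment

namespace LinearSetContainment

/-! Let `n` bound `c` and all periods. If the containment fails, it fails below `(n + 1) ^ 2`
(`linearSet_subset_of_forall_lt`). Write an element of the first set as `c` plus a list of positive
periods, and let `q` be a positive period in `P'`. If the list has at least `q` terms, two of its
prefix sums agree modulo `q`, so some block sums to a multiple of `q` (`exists_block_sum_dvd`).
Deleting the block gives a smaller element of the first set; if that lies in the second set, so does
the original. Hence a least counterexample uses fewer than `q` periods.

Membership below the bound is computed by dynamic programming: `x` belongs to a linear set iff it is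
the constant or `x - p` belongs for some positive period `p` (`mem_linearSet_iff`). A stack holds
the answers for all numbers below `x`. Since the input is unary, it serves as a ruler: moving one
cell per tick of a period `p` exposes the entry of `x - p`. Each `x` costs one pass over the input
and back, which is linear in `n`, so the total is cubic (`reach_loop`, `reach_decide`). -/

/-! ### Linear sets and the bound on counterexamples -/

theorem self_mem_linearSet (c : ℕ) (P : Finset ℕ) : c ∈ linearSet c P :=
  ⟨0, by simp⟩

theorem add_mem_linearSet {c : ℕ} {P : Finset ℕ} {x p : ℕ} (hx : x ∈ linearSet c P) (hp : p ∈ P) :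
    x + p ∈ linearSet c P := by
  obtain ⟨a, rfl⟩ := hx
  refine ⟨fun i => a i + if i = p then 1 else 0, ?_⟩
  simp [add_mul, Finset.sum_add_distrib, hp, add_assoc]

theorem add_mul_mem_linearSet {c : ℕ} {P : Finset ℕ} {x p : ℕ} (hx : x ∈ linearSet c P)
    (hp : p ∈ P) (k : ℕ) : x + p * k ∈ linearSet c P := by
  induction k with
  | zero => simpa using hx
  | succ k ih => simpa [mul_add, add_assoc] using add_mem_linearSet ih hp

theorem mem_linearSet_iff {c : ℕ} {P : Finset ℕ} {x : ℕ} :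
    x ∈ linearSet c P ↔ x = c ∨ ∃ p ∈ P, 0 < p ∧ p ≤ x ∧ x - p ∈ linearSet c P := by
  constructor
  · rintro ⟨a, rfl⟩
    by_cases h : ∑ p ∈ P, a p * p = 0
    · simp [h]
    · obtain ⟨p, hp, hne⟩ := Finset.exists_ne_zero_of_sum_ne_zero h
      obtain ⟨ha, hp0⟩ := mul_ne_zero_iff.mp hne
      obtain ⟨m, hm⟩ := Nat.exists_eq_succ_of_ne_zero ha
      have hsum : ∑ i ∈ P, a i * i = (∑ i ∈ P, Function.update a p m i * i) + p := by
        rw [← Finset.add_sum_erase _ _ hp, ← Finset.add_sum_erase _ _ hp]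
        have : ∑ i ∈ P.erase p, Function.update a p m i * i = ∑ i ∈ P.erase p, a i * i :=
          Finset.sum_congr rfl fun i hi => by
            rw [Function.update_of_ne (Finset.ne_of_mem_erase hi)]
        rw [this, Function.update_self, hm, Nat.succ_mul]
        ring
      refine Or.inr ⟨p, hp, Nat.pos_of_ne_zero hp0, by omega, Function.update a p m, by omega⟩
  · rintro (rfl | ⟨p, hp, -, hle, hx⟩)
    · exact self_mem_linearSet _ _
    · simpa [Nat.sub_add_cancel hle] using add_mem_linearSet hx hp

theorem add_list_sum_mem_linearSet {c : ℕ} {P : Finset ℕ} {l : List ℕ} (hl : ∀ p ∈ l, p ∈ P) :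
    c + l.sum ∈ linearSet c P := by
  induction l with
  | nil => simpa using self_mem_linearSet c P
  | cons p l ih =>
    have h := add_mem_linearSet (ih fun q hq => hl q (by simp [hq])) (hl p (by simp))
    rwa [List.sum_cons, add_comm p, ← add_assoc]

/-- Listing the periods with multiplicity makes blocks of consecutive summands available; positivity
of the terms lets a nonempty list change the value. -/
theorem exists_list_of_mem_linearSet {c : ℕ} {P : Finset ℕ} {x : ℕ} (hx : x ∈ linearSet c P) :
    ∃ l : List ℕ, (∀ p ∈ l, p ∈ P ∧ 0 < p) ∧ x = c + l.sum := by
  induction x using Nat.strong_induction_on with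
  | _ x ih =>
    rcases mem_linearSet_iff.mp hx with rfl | ⟨p, hp, h0, hle, hmem⟩
    · exact ⟨[], by simp⟩
    · obtain ⟨l, hl, hsum⟩ := ih (x - p) (by omega) hmem
      refine ⟨p :: l, by simpa [hp, h0] using hl, ?_⟩
      rw [List.sum_cons]
      omega

/-- A list of at least `q` numbers has a nonempty block of consecutive entries whose sum is
divisible by `q`. -/
theorem exists_block_sum_dvd {q : ℕ} (hq : 0 < q) {l : List ℕ} (hl : q ≤ l.length) :
    ∃ l₁ l₂ l₃ k, l = l₁ ++ l₂ ++ l₃ ∧ l₂ ≠ [] ∧ l₂.sum = q * k := by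
  -- Pigeonhole: `q + 1` prefix sums, `q` residues.
  obtain ⟨i, hi, j, hj, hne, heq⟩ := Finset.exists_ne_map_eq_of_card_lt_of_maps_to
    (s := Finset.range (q + 1)) (t := Finset.range q) (f := fun i => (l.take i).sum % q)
    (by simp) (fun i _ => by simpa using Nat.mod_lt _ hq)
  wlog hij : i < j generalizing i j
  · exact this j hj i hi hne.symm heq.symm (by omega)
  simp only [Finset.mem_range] at hi hj
  have hsplit : l.take j = l.take i ++ (l.drop i).take (j - i) := by
    rw [← List.take_add, Nat.add_sub_cancel' hij.le]
  have hsum : (l.take j).sum = (l.take i).sum + ((l.drop i).take (j - i)).sum := by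
    rw [hsplit, List.sum_append]
  obtain ⟨k, hk⟩ : q ∣ ((l.drop i).take (j - i)).sum := by
    have := (Nat.modEq_iff_dvd' (by omega)).mp
      (show (l.take i).sum ≡ (l.take j).sum [MOD q] from heq)
    rwa [hsum, Nat.add_sub_cancel_left] at this
  refine ⟨l.take i, (l.drop i).take (j - i), l.drop j, k, ?_, ?_, hk⟩
  · rw [← hsplit, List.take_append_drop]
  · intro h
    have := congrArg List.length h
    simp at this
    omega

theorem linearSet_subset_of_forall_lt {c c' n : ℕ} {P P' : Finset ℕ} (hc : c ≤ n)
    (hP : ∀ p ∈ P, p ≤ n) (hP' : ∀ p ∈ P', p ≤ n)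
    (h : ∀ x < (n + 1) ^ 2, x ∈ linearSet c P → x ∈ linearSet c' P') :
    linearSet c P ⊆ linearSet c' P' := by
  intro x hx
  obtain ⟨l, hl, rfl⟩ := exists_list_of_mem_linearSet hx
  by_cases hq : ∃ q ∈ P', 0 < q
  · obtain ⟨q, hqP, hq0⟩ := hq
    clear hx
    induction hlen : l.length using Nat.strong_induction_on generalizing l with
    | _ m ih =>
      by_cases hm : q ≤ l.length
      · obtain ⟨l₁, l₂, l₃, k, rfl, hne, hk⟩ := exists_block_sum_dvd hq0 hm
        have hpos : 0 < l₂.length := List.length_pos_iff.mpr hne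
        have hmem := ih (l₁ ++ l₃).length (by simp at hlen ⊢; omega) (l₁ ++ l₃)
          (fun p hp => hl p (by simp at hp ⊢; tauto)) rfl
        have heq : c + (l₁ ++ l₂ ++ l₃).sum = c + (l₁ ++ l₃).sum + q * k := by
          simp only [List.sum_append, hk]
          ring
        rw [heq]
        exact add_mul_mem_linearSet hmem hqP k
      -- Fewer than `q ≤ n` summands, each at most `n`, added to `c ≤ n`, stay below `(n + 1) ^ 2`.
      · refine h _ ?_ (add_list_sum_mem_linearSet fun p hp => (hl p hp).1)
        have hsum := List.sum_le_card_nsmul l n fun p hp => hP p (hl p hp).1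
        have := hP' q hqP
        rw [smul_eq_mul] at hsum
        nlinarith
  -- Without a positive period the second set is a singleton, so testing `c` and `c + p`, both at
  -- most `2 * n`, suffices.
  · have hsingle : ∀ y ∈ linearSet c' P', y = c' := by
      intro y hy
      rcases mem_linearSet_iff.mp hy with h | ⟨p, hp, h0, -⟩
      · exact h
      · exact absurd ⟨p, hp, h0⟩ hq
    have hcmem := h c (by nlinarith) (self_mem_linearSet c P)
    cases l with
    | nil => simpa using hcmem
    | cons p l =>
      obtain ⟨hp, h0⟩ := hl p (by simp)
      have := hsingle _ (h (c + p) (by nlinarith [hP p hp])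
        (add_mem_linearSet (self_mem_linearSet c P) hp))
      have := hsingle _ hcmem
      omega

/-! ### The stack machine -/

/-- The stacks of the decision procedure. -/
inductive Stk
  | inp
  | rev
  | tbl
  | aux
  | cnt
  | lap
  | out
  deriving DecidableEq

instance : Fintype Stk where
  elems := {.inp, .rev, .tbl, .aux, .cnt, .lap, .out}
  complete k := by cases k <;> simp

/-- An entry of the membership table: the bottom mark `none`, or a pair of bits telling whether a
number belongs to the first and to the second linear set. -/
abbrev Cell := Option (Bool × Bool)

/-- The alphabets of the stacks. -/
abbrev Alph : Stk → Type
  | .inp => Sym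
  | .rev => Sym
  | .tbl => Cell
  | .aux => Cell
  | .cnt => Unit
  | .lap => Unit
  | .out => Bool

/-- The labels of the program. -/
inductive Lbl
  | read
  | rewind
  | walk
  | restore
  | finish
  | clear (b : Bool)
  deriving Fintype

/-- The finite memory. The fields `sym`, `top`, `top'` and `found` only carry values inside a
single step. -/
@[ext]
structure Reg where
  sym : Option Sym := none
  top : Option Cell := none
  top' : Option Cell := none
  found : Bool := false
  right : Bool := false
  period : Bool := false
  last : Bool := false
  refill : Bool := false
  accL : Bool := false
  accR : Bool := false

noncomputable instance : Fintype Reg :=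
  Fintype.ofInjective
    (fun v : Reg => (v.sym, v.top, v.top', v.found, v.right, v.period, v.last, v.refill, v.accL,
      v.accR))
    fun v w h => by
      simp only [Prod.mk.injEq] at h
      exact Reg.ext h.1 h.2.1 h.2.2.1 h.2.2.2.1 h.2.2.2.2.1 h.2.2.2.2.2.1 h.2.2.2.2.2.2.1
        h.2.2.2.2.2.2.2.1 h.2.2.2.2.2.2.2.2.1 h.2.2.2.2.2.2.2.2.2

/-- Forget the values that were read from the stacks. -/
def Reg.clean (v : Reg) : Reg :=
  { v with sym := none, top := none, top' := none, found := false }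

/-- The bit of a table entry that belongs to the first (`false`) or second (`true`) set. -/
def Cell.bit (right : Bool) : Option Cell → Bool
  | some (some b) => if right then b.2 else b.1
  | _ => false

/-- Whether the segment just read shows that the current number belongs to the linear set. -/
def Reg.hit (v : Reg) : Bool :=
  if v.period then Cell.bit v.right v.top' else v.top == some none

/-- The effect of the end of a segment on the memory. -/
def Reg.eval (v : Reg) : Reg :=
  { v with
    accL := v.accL || (!v.right && v.hit)
    accR := v.accR || (v.right && v.hit)
    right := v.right || v.sym == some .semicolon
    period := v.sym != some .semicolon
    last := v.sym == none }

open Turing.TM2.Stmt in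
/-- The program. The number `x` under consideration is the height of the table above its mark. -/
def program : Lbl → Turing.TM2.Stmt Alph Lbl Reg
  | .read =>
    pop .inp (fun v a => { v with sym := a }) <|
    branch (fun v => v.sym.isSome)
      (push .rev (fun v => v.sym.getD .tick) <|
        push .lap (fun _ => ()) <|
        -- In this first pass `right` means at least one semicolon and `last` at least two.
        load (fun v => { v with
          right := v.right || v.sym == some .semicolon
          last := v.last || (v.right && v.sym == some .semicolon) }) <|
        load Reg.clean <| goto fun _ => .read)
      (branch (fun v => v.right && !v.last)
        (push .tbl (fun _ => none) <| load (fun _ => { refill := true }) <| goto fun _ => .rewind)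
        (load (fun _ => {}) <| goto fun _ => .clear false))
  | .rewind =>
    pop .rev (fun v a => { v with sym := a }) <|
    branch (fun v => v.sym.isSome)
      (push .inp (fun v => v.sym.getD .tick) <|
        load Reg.clean <|
        branch (fun v => v.refill)
          (push .cnt (fun _ => ()) <| goto fun _ => .rewind)
          (goto fun _ => .rewind))
      (load (fun _ => {}) <| goto fun _ => .walk)
  | .walk =>
    pop .inp (fun v a => { v with sym := a }) <|
    branch (fun v => v.sym == some .tick)
      (push .rev (fun _ => .tick) <|
        pop .tbl (fun v a => { v with top := a }) <|
        branch (fun v => v.top.isSome)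
          (push .aux (fun v => v.top.getD none) <| load Reg.clean <| goto fun _ => .walk)
          (load Reg.clean <| goto fun _ => .walk))
      -- After `p` ticks the top of `tbl` is the bottom mark exactly when `p = x`, which tests a
      -- constant; for `0 < p ≤ x` the top of `aux` is the entry of `x - p`, which tests a period.
      (peek .tbl (fun v a => { v with top := a }) <|
        peek .aux (fun v a => { v with top' := a }) <|
        load Reg.eval <|
        branch (fun v => v.sym.isSome)
          (push .rev (fun v => v.sym.getD .tick) <| load Reg.clean <| goto fun _ => .restore)
          (load Reg.clean <| goto fun _ => .restore))
  | .restore =>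
    pop .aux (fun v a => { v with top := a }) <|
    branch (fun v => v.top.isSome)
      (push .tbl (fun v => v.top.getD none) <| load Reg.clean <| goto fun _ => .restore)
      (goto fun v => if v.last then .finish else .walk)
  | .finish =>
    branch (fun v => v.accL && !v.accR)
      (load (fun _ => {}) <| goto fun _ => .clear false)
      (push .tbl (fun v => some (v.accL, v.accR)) <|
        -- `cnt` and `lap` are the low and high digits of a countdown in base `n + 1`, where `n` is
        -- the input length; an exhausted `cnt` is refilled with `n` tokens during the next rewind.
        pop .cnt (fun v a => { v with found := a.isSome }) <|
        branch (fun v => v.found)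
          (load (fun _ => {}) <| goto fun _ => .rewind)
          (pop .lap (fun v a => { v with found := a.isSome }) <|
            branch (fun v => v.found)
              (load (fun _ => { refill := true }) <| goto fun _ => .rewind)
              (load (fun _ => {}) <| goto fun _ => .clear true)))
  | .clear b =>
    pop .inp (fun v a => { v with found := a.isSome }) <|
    pop .rev (fun v a => { v with found := v.found || a.isSome }) <|
    pop .tbl (fun v a => { v with found := v.found || a.isSome }) <|
    pop .aux (fun v a => { v with found := v.found || a.isSome }) <|
    pop .cnt (fun v a => { v with found := v.found || a.isSome }) <|
    pop .lap (fun v a => { v with found := v.found || a.isSome }) <|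
    branch (fun v => v.found)
      (load (fun _ => {}) <| goto fun _ => .clear b)
      (push .out (fun _ => b) <| load (fun _ => {}) <| halt)

/-- The machine that runs `program`. -/
noncomputable def machine : Turing.FinTM2 where
  K := Stk
  k₀ := .inp
  k₁ := .out
  Γ := Alph
  Λ := Lbl
  main := .read
  σ := Reg
  initialState := {}
  Γk₀Fin := inferInstanceAs (Fintype Sym)
  σFin := inferInstance
  m := program

/-! ### Configurations and timed reachability -/

/-- The family of stacks with the given contents. -/
def stackContents (i r : List Sym) (t a : List Cell) (c l : List Unit) (o : List Bool) :
    ∀ k, List (Alph k)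
  | .inp => i
  | .rev => r
  | .tbl => t
  | .aux => a
  | .cnt => c
  | .lap => l
  | .out => o

/-- The configuration with the given label, memory and stacks. -/
def config (q : Option Lbl) (v : Reg) (i r : List Sym) (t a : List Cell) (c l : List Unit)
    (o : List Bool) : machine.Cfg :=
  ⟨q, v, stackContents i r t a c l o⟩

section stackContents

variable (i r : List Sym) (t a : List Cell) (c l : List Unit) (o : List Bool)

@[simp] theorem stackContents_inp : stackContents i r t a c l o .inp = i := rfl
@[simp] theorem stackContents_rev : stackContents i r t a c l o .rev = r := rfl
@[simp] theorem stackContents_tbl : stackContents i r t a c l o .tbl = t := rfl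
@[simp] theorem stackContents_aux : stackContents i r t a c l o .aux = a := rfl
@[simp] theorem stackContents_cnt : stackContents i r t a c l o .cnt = c := rfl
@[simp] theorem stackContents_lap : stackContents i r t a c l o .lap = l := rfl

@[simp] theorem update_stackContents_inp (s : List Sym) :
    Function.update (stackContents i r t a c l o) .inp s = stackContents s r t a c l o := by
  funext k; cases k <;> rfl

@[simp] theorem update_stackContents_rev (s : List Sym) :
    Function.update (stackContents i r t a c l o) .rev s = stackContents i s t a c l o := by
  funext k; cases k <;> rfl

@[simp] theorem update_stackContents_tbl (s : List Cell) :
    Function.update (stackContents i r t a c l o) .tbl s = stackContents i r s a c l o := by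
  funext k; cases k <;> rfl

@[simp] theorem update_stackContents_aux (s : List Cell) :
    Function.update (stackContents i r t a c l o) .aux s = stackContents i r t s c l o := by
  funext k; cases k <;> rfl

@[simp] theorem update_stackContents_cnt (s : List Unit) :
    Function.update (stackContents i r t a c l o) .cnt s = stackContents i r t a s l o := by
  funext k; cases k <;> rfl

@[simp] theorem update_stackContents_lap (s : List Unit) :
    Function.update (stackContents i r t a c l o) .lap s = stackContents i r t a c s o := by
  funext k; cases k <;> rfl

@[simp] theorem stackContents_out : stackContents i r t a c l o .out = o := rfl

@[simp] theorem update_stackContents_out (s : List Bool) :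
    Function.update (stackContents i r t a c l o) .out s = stackContents i r t a c l s := by
  funext k; cases k <;> rfl

end stackContents

theorem step_config (q : Lbl) (v : Reg) (i r : List Sym) (t a : List Cell) (c l : List Unit)
    (o : List Bool) :
    machine.step (config (some q) v i r t a c l o) =
      some (Turing.TM2.stepAux (program q) v (stackContents i r t a c l o)) := rfl

/-- The machine gets from `x` to `y` in at most `n` steps. -/
def Reach (n : ℕ) (x y : machine.Cfg) : Prop :=
  Nonempty (StateTransition.EvalsToInTime machine.step x (some y) n)

theorem Reach.refl (x : machine.Cfg) : Reach 0 x x :=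
  ⟨StateTransition.EvalsToInTime.refl _ _⟩

theorem Reach.of_step {x y : machine.Cfg} (h : machine.step x = some y) : Reach 1 x y :=
  ⟨⟨⟨1, h⟩, le_rfl⟩⟩

theorem Reach.mono {m n : ℕ} {x y : machine.Cfg} (h : Reach m x y) (hmn : m ≤ n) : Reach n x y :=
  h.elim fun e => ⟨⟨e.toEvalsTo, e.steps_le_m.trans hmn⟩⟩

theorem Reach.trans {m n : ℕ} {x y z : machine.Cfg} (h : Reach m x y) (h' : Reach n y z) :
    Reach (m + n) x z :=
  h.elim fun e => h'.elim fun e' =>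
    Reach.mono ⟨StateTransition.EvalsToInTime.trans _ _ _ _ _ _ e e'⟩ (by omega)

/-- A halting configuration must have all stacks empty except the output. Each round lowers the
total height, since it pops every nonempty stack. -/
theorem reach_clear (b : Bool) (i r : List Sym) (t a : List Cell) (c l : List Unit) :
    Reach (i.length + r.length + t.length + a.length + c.length + l.length + 1)
      (config (some (.clear b)) {} i r t a c l []) (config none {} [] [] [] [] [] [] [b]) := by
  induction hn : i.length + r.length + t.length + a.length + c.length + l.length
    using Nat.strong_induction_on generalizing i r t a c l with
  | _ n ih =>
    by_cases h0 : n = 0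
    · have : i = [] ∧ r = [] ∧ t = [] ∧ a = [] ∧ c = [] ∧ l = [] := by
        simp only [← List.length_eq_zero_iff]; omega
      obtain ⟨rfl, rfl, rfl, rfl, rfl, rfl⟩ := this
      subst h0
      exact .of_step (by rw [step_config]; simp [program]; rfl)
    · have hlt : i.tail.length + r.tail.length + t.tail.length + a.tail.length + c.tail.length +
          l.tail.length < n := by simp only [List.length_tail]; omega
      refine Reach.mono (Reach.trans (.of_step ?_) (ih _ hlt _ _ _ _ _ _ rfl)) (by omega)
      rw [step_config]
      have hfound : (i.head?.isSome || r.head?.isSome || t.head?.isSome || a.head?.isSome ||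
          c.head?.isSome || l.head?.isSome) = true := by
        by_contra hcon
        simp at hcon
        simp [hcon] at hn
        omega
      simp only [program, Turing.TM2.stepAux, stackContents_inp, stackContents_rev,
        stackContents_tbl, stackContents_aux, stackContents_cnt, stackContents_lap,
        update_stackContents_inp, update_stackContents_rev, update_stackContents_tbl,
        update_stackContents_aux, update_stackContents_cnt, update_stackContents_lap, hfound,
        cond_true]
      rfl

/-! ### Passes over the input -/

/-- The memory after reading `k` semicolons in the first pass over the input. -/
def Reg.counted (k : ℕ) : Reg :=
  { right := decide (0 < k), last := decide (1 < k) }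

theorem reach_read (w r : List Sym) (k : ℕ) (l : List Unit) :
    Reach w.length (config (some .read) (.counted k) w r [] [] [] l [])
      (config (some .read) (.counted (k + w.count .semicolon)) [] (w.reverse ++ r) [] [] []
        (List.replicate w.length () ++ l) []) := by
  induction w generalizing r k l with
  | nil => exact .refl _
  | cons s w ih =>
    have hstep : machine.step (config (some .read) (.counted k) (s :: w) r [] [] [] l []) =
        some (config (some .read) (.counted (k + [s].count .semicolon)) w (s :: r) [] [] []
          (() :: l) []) := by
      rw [step_config]
      rcases k with _ | _ | k <;> cases s <;> simp [program] <;> rfl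
    have := (Reach.of_step hstep).trans (ih (s :: r) _ (() :: l))
    rw [add_assoc, ← List.count_append, List.singleton_append] at this
    simpa [List.replicate_succ', add_comm] using this

theorem reach_rewind (w r : List Sym) (f : Bool) (t : List Cell) (c l : List Unit) :
    Reach (r.length + 1) (config (some .rewind) { refill := f } w r t [] c l [])
      (config (some .walk) {} (r.reverse ++ w) [] t []
        (List.replicate (if f then r.length else 0) () ++ c) l []) := by
  induction r generalizing w c with
  | nil => exact .of_step (by rw [step_config]; cases f <;> simp [program] <;> rfl)
  | cons s r ih =>
    have hstep : machine.step (config (some .rewind) { refill := f } w (s :: r) t [] c l []) =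
        some (config (some .rewind) { refill := f } (s :: w) r t []
          (List.replicate (if f then 1 else 0) () ++ c) l []) := by
      rw [step_config]
      cases f <;> simp [program] <;> rfl
    have := (Reach.of_step hstep).trans (ih _ _)
    cases f <;> simpa [List.replicate_succ', add_comm] using this

/-- The memory during the passes over the input that follow the first one. -/
def Reg.control (right period last accL accR : Bool) : Reg :=
  { right, period, last, accL, accR }

/-- `drop` and `take` also cover a segment longer than the table: the remaining ticks then move no
cell. -/
theorem reach_ticks (p : ℕ) (R per x y : Bool) (i r : List Sym) (t a : List Cell)
    (c l : List Unit) :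
    Reach p
      (config (some .walk) (.control R per false x y) (List.replicate p .tick ++ i) r t a c l [])
      (config (some .walk) (.control R per false x y) i (List.replicate p .tick ++ r)
        (t.drop p) ((t.take p).reverse ++ a) c l []) := by
  induction p generalizing r t a with
  | zero => exact .refl _
  | succ p ih =>
    have hstep : machine.step (config (some .walk) (.control R per false x y)
        (List.replicate (p + 1) .tick ++ i) r t a c l []) =
        some (config (some .walk) (.control R per false x y) (List.replicate p .tick ++ i)
          (.tick :: r) (t.drop 1) ((t.take 1).reverse ++ a) c l []) := by
      rw [step_config]
      cases t <;> simp [program, List.replicate_succ] <;> rfl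
    have := (Reach.of_step hstep).trans (ih _ _ _)
    cases t <;> simpa [List.replicate_succ', add_comm] using this

theorem reach_restore (R per last x y : Bool) (i r : List Sym) (t a : List Cell)
    (c l : List Unit) :
    Reach (a.length + 1) (config (some .restore) (.control R per last x y) i r t a c l [])
      (config (some (if last then .finish else .walk)) (.control R per last x y) i r
        (a.reverse ++ t) [] c l []) := by
  induction a generalizing t with
  | nil => exact .of_step (by rw [step_config]; simp [program]; rfl)
  | cons b a ih =>
    have hstep : machine.step (config (some .restore) (.control R per last x y) i r t (b :: a)
        c l []) =
        some (config (some .restore) (.control R per last x y) i r (b :: t) a c l []) := by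
      rw [step_config]
      simp [program]
      rfl
    simpa [add_comm] using (Reach.of_step hstep).trans (ih _)

/-- Whether a segment of length `p` shows that the height of the table above its mark belongs
to the linear set. -/
def hit (R per : Bool) (t : List Cell) (p : ℕ) : Bool :=
  if per then Cell.bit R (t.take p).reverse.head? else (t.drop p).head? == some none

theorem reach_segment (p : ℕ) (s : Option Sym) (hs : s ≠ some .tick) (R per x y : Bool)
    (i r : List Sym) (hi : s = none → i = []) (t : List Cell) (c l : List Unit) :
    Reach (2 * (p + 1))
      (config (some .walk) (.control R per false x y) (List.replicate p .tick ++ (s.toList ++ i))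
        r t [] c l [])
      (config (some (if s == none then .finish else .walk))
        (.control (R || s == some .semicolon) (s != some .semicolon) (s == none)
          (x || (!R && hit R per t p)) (y || (R && hit R per t p)))
        i (s.toList ++ (List.replicate p .tick ++ r)) t [] c l []) := by
  have hstep : machine.step (config (some .walk) (.control R per false x y) (s.toList ++ i)
        (List.replicate p .tick ++ r) (t.drop p) ((t.take p).reverse ++ []) c l []) =
      some (config (some .restore)
        (.control (R || s == some .semicolon) (s != some .semicolon) (s == none)
          (x || (!R && hit R per t p)) (y || (R && hit R per t p)))
        i (s.toList ++ (List.replicate p .tick ++ r)) (t.drop p) (t.take p).reverse c l []) := by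
    rw [step_config]
    rcases s with _ | _ | _ | _
    · obtain rfl := hi rfl
      simp [program, Reg.eval, Reg.hit, Reg.clean, Reg.control, hit, config]
      rfl
    · exact absurd rfl hs
    all_goals
      simp [program, Reg.eval, Reg.hit, Reg.clean, Reg.control, hit, config,
        show (Sym.comma == Sym.tick) = false from rfl,
        show (Sym.semicolon == Sym.tick) = false from rfl]
      rfl
  have := ((reach_ticks p R per x y (s.toList ++ i) r t [] c l).trans (.of_step hstep)).trans
    (reach_restore _ _ _ _ _ _ _ _ _ _ _)
  rw [List.reverse_reverse, List.take_append_drop] at this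
  -- `p` ticks, one step at the separator, and at most `p + 1` steps to restore the table.
  exact this.mono (by simp; omega)

/-- The terminator `s` is left general so that both linear sets are covered: a semicolon ends the
first, the end of the input the second. -/
theorem reach_encodeLinear (k : ℕ) (P : List ℕ) (s : Option Sym) (hs : s ≠ some .tick)
    (R per x y : Bool) (i r : List Sym) (hi : s = none → i = []) (t : List Cell)
    (c l : List Unit) :
    Reach (2 * ((encodeLinear k P).length + 1))
      (config (some .walk) (.control R per false x y) (encodeLinear k P ++ (s.toList ++ i))
        r t [] c l [])
      (config (some (if s == none then .finish else .walk))
        (.control (R || s == some .semicolon) (s != some .semicolon) (s == none)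
          (x || (!R && (hit R per t k || P.any (hit R true t))))
          (y || (R && (hit R per t k || P.any (hit R true t)))))
        i (s.toList ++ ((encodeLinear k P).reverse ++ r)) t [] c l []) := by
  induction P generalizing k per x y r with
  | nil => simpa [encodeLinear] using reach_segment k s hs R per x y i r hi t c l
  | cons p P ih =>
    have hseg := reach_segment k (some .comma) (by simp) R per x y
      (encodeLinear p P ++ (s.toList ++ i)) r (by simp) t c l
    rw [show (R || some Sym.comma == some .semicolon) = R from Bool.or_false R] at hseg
    have := hseg.trans (ih p true _ _ _)
    convert this.mono (n := 2 * ((encodeLinear k (p :: P)).length + 1)) ?_ using 1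
    · simp [encodeLinear]
    · cases R <;> simp [encodeLinear, Bool.or_assoc]
    · simp [encodeLinear]
      omega

/-! ### The membership table -/

open Classical in
/-- The membership table of the numbers below `x` for the sets `A` and `A'`. -/
noncomputable def table (A A' : Set ℕ) : ℕ → List Cell
  | 0 => [none]
  | x + 1 => some (decide (x ∈ A), decide (x ∈ A')) :: table A A' x

theorem length_table (A A' : Set ℕ) (x : ℕ) : (table A A' x).length = x + 1 := by
  induction x with
  | zero => rfl
  | succ x ih => simp [table, ih]

open Classical in
theorem getElem?_table_of_lt (A A' : Set ℕ) {x p : ℕ} (hp : p < x) :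
    (table A A' x)[p]? = some (some (decide (x - 1 - p ∈ A), decide (x - 1 - p ∈ A'))) := by
  induction x generalizing p with
  | zero => omega
  | succ x ih =>
    cases p with
    | zero => simp [table]
    | succ p =>
      rw [table, List.getElem?_cons_succ, ih (by omega), show x + 1 - 1 - (p + 1) = x - 1 - p by omega]

theorem getElem?_table_self (A A' : Set ℕ) (x : ℕ) : (table A A' x)[x]? = some none := by
  induction x with
  | zero => rfl
  | succ x ih => simpa [table] using ih

theorem hit_constant (R : Bool) (A A' : Set ℕ) (x p : ℕ) :
    hit R false (table A A' x) p = decide (x = p) := by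
  rw [hit, List.head?_drop]
  rcases lt_trichotomy p x with h | rfl | h
  · simp [getElem?_table_of_lt A A' h, h.ne']
  · simp [getElem?_table_self]
  · simp [List.getElem?_eq_none (l := table A A' x) (i := p) (by rw [length_table]; omega), h.ne]

theorem getLast?_table (A A' : Set ℕ) (x : ℕ) : (table A A' x).getLast? = some none := by
  rw [List.getLast?_eq_getElem?, length_table, Nat.add_sub_cancel, getElem?_table_self]

open Classical in
-- The cell moved last has index `p - 1`, hence belongs to `x - p`. The degenerate cases read
-- `false`: nothing is moved for `p = 0`, and the mark is moved last for `p > x`.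
theorem hit_period (R : Bool) (A A' : Set ℕ) (x p : ℕ) :
    hit R true (table A A' x) p = decide (0 < p ∧ p ≤ x ∧ x - p ∈ if R then A' else A) := by
  rw [hit, if_pos rfl, List.head?_reverse, List.getLast?_take]
  rcases Nat.eq_zero_or_pos p with rfl | hp
  · simp [Cell.bit]
  · rcases le_or_gt p x with h | h
    · rw [if_neg hp.ne', getElem?_table_of_lt A A' (by omega), show x - 1 - (p - 1) = x - p by omega]
      cases R <;> simp [Cell.bit, hp, h]
    · have : (table A A' x)[p - 1]?.or (table A A' x).getLast? = some none := by
        rcases Nat.lt_or_ge x (p - 1) with h' | h'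
        · rw [List.getElem?_eq_none (by rw [length_table]; omega), getLast?_table]
          rfl
        · rw [show p - 1 = x by omega, getElem?_table_self]
          rfl
      rw [if_neg hp.ne', this]
      simp [Cell.bit, h]

open Classical in
-- The tests made in one pass are the two alternatives of `mem_linearSet_iff`.
theorem hit_or_any_eq (R : Bool) (A A' : Set ℕ) (c x : ℕ) (P : List ℕ)
    (h : (if R then A' else A) = linearSet c P.toFinset) :
    (hit R false (table A A' x) c || P.any (hit R true (table A A' x))) =
      decide (x ∈ linearSet c P.toFinset) := by
  rw [Bool.eq_iff_iff, decide_eq_true_iff, mem_linearSet_iff]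
  simp only [Bool.or_eq_true, List.any_eq_true, hit_constant, hit_period, decide_eq_true_iff, h,
    List.mem_toFinset]

theorem length_encodeInstance (c : ℕ) (P : List ℕ) (c' : ℕ) (P' : List ℕ) :
    (encodeInstance c P c' P').length =
      (encodeLinear c P).length + (encodeLinear c' P').length + 1 := by
  simp [encodeInstance, add_assoc]

open Classical in
theorem reach_walk (c : ℕ) (P : List ℕ) (c' : ℕ) (P' : List ℕ) (x : ℕ) (k l : List Unit) :
    Reach (2 * ((encodeInstance c P c' P').length + 1))
      (config (some .walk) {} (encodeInstance c P c' P') []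
        (table (linearSet c P.toFinset) (linearSet c' P'.toFinset) x) [] k l [])
      (config (some .finish)
        (.control true true true (decide (x ∈ linearSet c P.toFinset))
          (decide (x ∈ linearSet c' P'.toFinset)))
        [] (encodeInstance c P c' P').reverse
        (table (linearSet c P.toFinset) (linearSet c' P'.toFinset) x) [] k l []) := by
  set t := table (linearSet c P.toFinset) (linearSet c' P'.toFinset) x
  have h₁ := reach_encodeLinear c P (some .semicolon) (by simp) false false false false
    (encodeLinear c' P') [] (by simp) t k l
  have h₂ := reach_encodeLinear c' P' none (by simp) true false (decide (x ∈ linearSet c P.toFinset))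
    false [] (.semicolon :: (encodeLinear c P).reverse) (by simp) t k l
  have e₁ : (hit false false t c || P.any (hit false true t)) = _ :=
    hit_or_any_eq false _ _ c x P rfl
  have e₂ : (hit true false t c' || P'.any (hit true true t)) = _ :=
    hit_or_any_eq true _ _ c' x P' rfl
  rw [e₁] at h₁
  rw [e₂] at h₂
  have h₁' : Reach (2 * ((encodeLinear c P).length + 1))
      (config (some .walk) {} (encodeInstance c P c' P') [] t [] k l [])
      (config (some .walk) (.control true false false (decide (x ∈ linearSet c P.toFinset)) false)
        (encodeLinear c' P') (.semicolon :: (encodeLinear c P).reverse) t [] k l []) := by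
    simpa [encodeInstance, Reg.control] using h₁
  have h₂' : Reach (2 * ((encodeLinear c' P').length + 1)) (config (some .walk)
        (.control true false false (decide (x ∈ linearSet c P.toFinset)) false)
        (encodeLinear c' P') (.semicolon :: (encodeLinear c P).reverse) t [] k l [])
      (config (some .finish)
        (.control true true true (decide (x ∈ linearSet c P.toFinset))
          (decide (x ∈ linearSet c' P'.toFinset)))
        [] (encodeInstance c P c' P').reverse t [] k l []) := by
    simpa [encodeInstance, show (none != some Sym.semicolon) = true from rfl] using h₂
  exact (h₁'.trans h₂').mono (by rw [length_encodeInstance]; omega)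

theorem le_length_encodeLinear (c : ℕ) (P : List ℕ) :
    c ≤ (encodeLinear c P).length ∧ ∀ p ∈ P, p ≤ (encodeLinear c P).length := by
  induction P generalizing c with
  | nil => simp [encodeLinear]
  | cons q P ih =>
    obtain ⟨h₁, h₂⟩ := ih q
    simp only [encodeLinear, List.length_append, List.length_replicate, List.length_cons,
      List.mem_cons, forall_eq_or_imp]
    exact ⟨by omega, by omega, fun p hp => by have := h₂ p hp; omega⟩

/-! ### The main loop -/

open Classical in
-- Induction on the countdown `j + k * (n + 1)`. A round costs `2 * (n + 1)` steps for the walk, one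
-- for the verdict and `n + 1` for the rewind, in all `3 * n + 4`; the other summand of the bound
-- pays for clearing the stacks.
theorem reach_loop (c : ℕ) (P : List ℕ) (c' : ℕ) (P' : List ℕ) (x j k n : ℕ)
    (hn : n = (encodeInstance c P c' P').length) (hx : x + j + k * (n + 1) + 1 = (n + 1) ^ 2)
    (hj : j ≤ n) (hk : k ≤ n)
    (h : ∀ y < x, y ∈ linearSet c P.toFinset → y ∈ linearSet c' P'.toFinset) :
    Reach ((j + k * (n + 1) + 1) * (3 * n + 4) + ((n + 1) ^ 2 + 3 * n + 3))
      (config (some .walk) {} (encodeInstance c P c' P') []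
        (table (linearSet c P.toFinset) (linearSet c' P'.toFinset) x) []
        (List.replicate j ()) (List.replicate k ()) [])
      (config none {} [] [] [] [] [] []
        [decide (linearSet c P.toFinset ⊆ linearSet c' P'.toFinset)]) := by
  obtain ⟨w, hw⟩ : ∃ w, w = encodeInstance c P c' P' := ⟨_, rfl⟩
  rw [← hw] at hn ⊢
  set A := linearSet c P.toFinset with hA
  set A' := linearSet c' P'.toFinset with hA'
  induction hm : j + k * (n + 1) using Nat.strong_induction_on generalizing x j k with
  | _ m ih =>
    have hwalk : Reach (2 * (n + 1)) _ _ :=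
      hn ▸ hw ▸ reach_walk c P c' P' x (List.replicate j ()) (List.replicate k ())
    rw [← hA, ← hA'] at hwalk
    by_cases hbad : x ∈ A ∧ x ∉ A'
    · have hsub : ¬ A ⊆ A' := fun hsub => hbad.2 (hsub hbad.1)
      have hstep : machine.step (config (some .finish)
          (.control true true true (decide (x ∈ A)) (decide (x ∈ A'))) [] w.reverse
          (table A A' x) [] (List.replicate j ()) (List.replicate k ()) []) =
          some (config (some (.clear false)) {} [] w.reverse (table A A' x) []
            (List.replicate j ()) (List.replicate k ()) []) := by
        rw [step_config, decide_eq_true hbad.1, decide_eq_false hbad.2]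
        simp [program, Reg.control]
        rfl
      rw [decide_eq_false hsub]
      refine ((hwalk.trans (.of_step hstep)).trans (reach_clear _ _ _ _ _ _ _)).mono ?_
      simp only [List.length_nil, List.length_reverse, List.length_replicate, length_table, ← hn]
      nlinarith
    · have hgood : (decide (x ∈ A) && !decide (x ∈ A')) = false := by
        simpa using hbad
      have hlt : ∀ y < x + 1, y ∈ A → y ∈ A' := by
        intro y hy hyA
        rcases Nat.lt_succ_iff_lt_or_eq.mp hy with hy | rfl
        · exact h y hy hyA
        · by_contra hyA'
          exact hbad ⟨hyA, hyA'⟩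
      rcases j with _ | j
      · rcases k with _ | k
        · have hstep : machine.step (config (some .finish)
              (.control true true true (decide (x ∈ A)) (decide (x ∈ A'))) [] w.reverse
              (table A A' x) [] [] [] []) =
              some (config (some (.clear true)) {} [] w.reverse (table A A' (x + 1)) [] [] []
                []) := by
            rw [step_config]
            simp [program, Reg.control, hgood, table]
            rfl
          obtain ⟨hc, hP⟩ := le_length_encodeLinear c P
          obtain ⟨-, hP'⟩ := le_length_encodeLinear c' P'
          have hlen := length_encodeInstance c P c' P'
          rw [← hw, ← hn] at hlen
          -- With the countdown at zero, `x + 1 = (n + 1) ^ 2`, so every number below the bound has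
          -- passed.
          have hsub : A ⊆ A' := linearSet_subset_of_forall_lt (n := n) (by omega)
            (fun p hp => by have := hP p (by simpa using hp); omega)
            (fun p hp => by have := hP' p (by simpa using hp); omega)
            (fun y hy => hlt y (by omega))
          rw [decide_eq_true hsub]
          refine ((hwalk.trans (.of_step hstep)).trans (reach_clear _ _ _ _ _ _ _)).mono ?_
          simp only [List.length_nil, List.length_reverse, length_table, ← hn]
          nlinarith
        · have hstep : machine.step (config (some .finish)
              (.control true true true (decide (x ∈ A)) (decide (x ∈ A'))) [] w.reverse
              (table A A' x) [] [] (List.replicate (k + 1) ()) []) =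
              some (config (some .rewind) { refill := true } [] w.reverse (table A A' (x + 1)) [] []
                (List.replicate k ()) []) := by
            rw [step_config]
            simp [program, Reg.control, hgood, table, List.replicate_succ]
            rfl
          have hrew := reach_rewind [] w.reverse true (table A A' (x + 1)) []
            (List.replicate k ())
          simp only [List.reverse_reverse, List.append_nil, List.length_reverse, if_true, ← hn]
            at hrew
          refine (((hwalk.trans (.of_step hstep)).trans hrew).trans
            (ih (n + k * (n + 1)) (by rw [← hm]; linarith) (x + 1) n k (by linarith) le_rfl
              (by omega) hlt rfl)).mono ?_
          rw [← hm]
          apply le_of_eq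
          ring
      · have hstep : machine.step (config (some .finish)
            (.control true true true (decide (x ∈ A)) (decide (x ∈ A'))) [] w.reverse
            (table A A' x) [] (List.replicate (j + 1) ()) (List.replicate k ()) []) =
            some (config (some .rewind) { refill := false } [] w.reverse (table A A' (x + 1)) []
              (List.replicate j ()) (List.replicate k ()) []) := by
          rw [step_config]
          simp [program, Reg.control, hgood, table, List.replicate_succ]
          rfl
        have hrew := reach_rewind [] w.reverse false (table A A' (x + 1)) (List.replicate j ())
          (List.replicate k ())
        simp only [List.reverse_reverse, List.append_nil, List.length_reverse, Bool.false_eq_true,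
          if_false, List.replicate_zero, List.nil_append, ← hn] at hrew
        refine (((hwalk.trans (.of_step hstep)).trans hrew).trans
          (ih (j + k * (n + 1)) (by omega) (x + 1) j k (by linarith) (by omega) hk hlt rfl)).mono ?_
        rw [← hm]
        apply le_of_eq
        ring

/-! ### Parsing and unique decoding -/

theorem exists_eq_encodeLinear (u : List Sym) (hu : .semicolon ∉ u) :
    ∃ c P, u = encodeLinear c P := by
  induction u with
  | nil => exact ⟨0, [], rfl⟩
  | cons s u ih =>
    obtain ⟨c, P, rfl⟩ := ih fun h => hu (List.mem_cons_of_mem _ h)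
    cases s with
    | tick => exact ⟨c + 1, P, by cases P <;> simp [encodeLinear, List.replicate_succ]⟩
    | comma => exact ⟨0, c :: P, rfl⟩
    | semicolon => simp at hu

theorem count_encodeLinear (c : ℕ) (P : List ℕ) : (encodeLinear c P).count .semicolon = 0 := by
  induction P generalizing c with
  | nil => simp [encodeLinear, List.count_replicate]
  | cons p P ih => simp [encodeLinear, List.count_replicate, ih]

theorem count_encodeInstance (c : ℕ) (P : List ℕ) (c' : ℕ) (P' : List ℕ) :
    (encodeInstance c P c' P').count .semicolon = 1 := by
  simp [encodeInstance, count_encodeLinear]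

/-- This is why counting semicolons is the only syntax check needed. -/
theorem exists_eq_encodeInstance (w : List Sym) (hw : w.count .semicolon = 1) :
    ∃ c P c' P', w = encodeInstance c P c' P' := by
  obtain ⟨u, v, rfl⟩ := List.append_of_mem (List.count_pos_iff.mp (by rw [hw]; exact one_pos))
  simp only [List.count_append, List.count_cons_self] at hw
  obtain ⟨c, P, rfl⟩ := exists_eq_encodeLinear u (List.count_eq_zero.mp (by omega))
  obtain ⟨c', P', rfl⟩ := exists_eq_encodeLinear v (List.count_eq_zero.mp (by omega))
  exact ⟨c, P, c', P', rfl⟩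

/-- The constant and the list of periods that a string without semicolons encodes. -/
def decodeLinear : List Sym → ℕ × List ℕ
  | [] => (0, [])
  | .tick :: u => ((decodeLinear u).1 + 1, (decodeLinear u).2)
  | .comma :: u => (0, (decodeLinear u).1 :: (decodeLinear u).2)
  -- An arbitrary value: codes of linear sets contain no semicolon.
  | .semicolon :: u => decodeLinear u

theorem decodeLinear_replicate_append (c : ℕ) (u : List Sym) :
    decodeLinear (List.replicate c .tick ++ u) = ((decodeLinear u).1 + c, (decodeLinear u).2) := by
  induction c with
  | zero => rfl
  | succ c ih => rw [List.replicate_succ, List.cons_append, decodeLinear, ih]; rfl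

theorem decodeLinear_encodeLinear (c : ℕ) (P : List ℕ) :
    decodeLinear (encodeLinear c P) = (c, P) := by
  induction P generalizing c with
  | nil => simpa [encodeLinear, decodeLinear] using decodeLinear_replicate_append c []
  | cons p P ih => rw [encodeLinear, decodeLinear_replicate_append, decodeLinear, ih]; simp

/-- The language quantifies over all instances with the given code, so the code has to be injective:
its only semicolon splits it, and `decodeLinear` inverts each half. -/
theorem encodeInstance_mem_iff (c : ℕ) (P : List ℕ) (c' : ℕ) (P' : List ℕ) :
    encodeInstance c P c' P' ∈ unaryContainment ↔
      linearSet c P.toFinset ⊆ linearSet c' P'.toFinset := by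
  refine ⟨?_, fun h => ⟨c, P, c', P', rfl, h⟩⟩
  rintro ⟨d, Q, d', Q', heq, h⟩
  have hnot (e : ℕ) (S : List ℕ) : Sym.semicolon ∉ encodeLinear e S :=
    List.count_eq_zero.mp (count_encodeLinear e S)
  obtain ⟨h₁, -, h₂⟩ := (List.append_cons_inj_of_notMem (hnot c P) (hnot c' P')).mp heq
  have h₁ := congrArg decodeLinear h₁
  have h₂ := congrArg decodeLinear h₂
  simp only [decodeLinear_encodeLinear, Prod.mk.injEq] at h₁ h₂
  rwa [h₁.1, h₁.2, h₂.1, h₂.2]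

/-! ### Running time and conclusion -/

/-- A bound on the running time of the machine. -/
noncomputable def timeBound : Polynomial ℕ :=
  (.X + 1) ^ 2 * (3 * .X + 5) + 5 * .X + 5

open Classical in
theorem reach_decide (w : List Sym) :
    Reach (timeBound.eval w.length) (config (some .read) {} w [] [] [] [] [] [])
      (config none {} [] [] [] [] [] [] [decide (w ∈ unaryContainment)]) := by
  have heval : timeBound.eval w.length =
      (w.length + 1) ^ 2 * (3 * w.length + 5) + 5 * w.length + 5 := by
    simp [timeBound]
  have hread := reach_read w [] 0 []
  simp only [zero_add, List.append_nil] at hread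
  rw [heval]
  by_cases hw : w.count .semicolon = 1
  · have hstep : machine.step (config (some .read) (.counted (w.count .semicolon)) [] w.reverse
        [] [] [] (List.replicate w.length ()) []) =
        some (config (some .rewind) { refill := true } [] w.reverse [none] [] []
          (List.replicate w.length ()) []) := by
      rw [step_config, hw]
      simp [program, Reg.counted]
      rfl
    have hrew := reach_rewind [] w.reverse true [none] [] (List.replicate w.length ())
    simp only [List.reverse_reverse, List.append_nil, List.length_reverse, if_true] at hrew
    obtain ⟨c, P, c', P', hcode⟩ := exists_eq_encodeInstance w hw
    -- Both digits start at `n`: `n + n * (n + 1) + 1 = (n + 1) ^ 2`.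
    have hloop := reach_loop c P c' P' 0 w.length w.length w.length (by rw [hcode]) (by ring)
      le_rfl le_rfl (by simp)
    have hmem : w ∈ unaryContainment ↔ _ := hcode ▸ encodeInstance_mem_iff c P c' P'
    rw [← hcode] at hloop
    rw [decide_eq_decide.mpr hmem]
    refine (((hread.trans (.of_step hstep)).trans hrew).trans hloop).mono ?_
    apply le_of_eq
    ring
  · have hmem : w ∉ unaryContainment := by
      rintro ⟨c, P, c', P', rfl, -⟩
      exact hw (count_encodeInstance c P c' P')
    have hstep : machine.step (config (some .read) (.counted (w.count .semicolon)) [] w.reverse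
        [] [] [] (List.replicate w.length ()) []) =
        some (config (some (.clear false)) {} [] w.reverse [] [] []
          (List.replicate w.length ()) []) := by
      rw [step_config]
      generalize w.count .semicolon = m at hw
      rcases m with _ | _ | m
      · simp [program, Reg.counted]
        rfl
      · exact absurd rfl hw
      · simp [program, Reg.counted]
        rfl
    rw [decide_eq_false hmem]
    refine ((hread.trans (.of_step hstep)).trans (reach_clear _ _ _ _ _ _ _)).mono ?_
    simp only [List.length_nil, List.length_reverse, List.length_replicate]
    nlinarith

theorem initList_machine (w : List Sym) :
    Turing.initList machine w = config (some .read) {} w [] [] [] [] [] [] := by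
  unfold Turing.initList config
  congr 1
  funext k
  cases k <;> rfl

theorem haltList_machine (o : List Bool) :
    Turing.haltList machine o = config none {} [] [] [] [] [] [] o := by
  unfold Turing.haltList config
  congr 1
  funext k
  cases k <;> rfl

open Classical in
/-- The machine decides the containment problem in polynomial time. -/
noncomputable def decisionProcedure :
    Turing.TM2ComputableInPolyTime (id : List Sym → List Sym) Computability.encodeBool
      (fun w => decide (w ∈ unaryContainment)) where
  tm := machine
  inputAlphabet := Equiv.refl Sym
  outputAlphabet := Equiv.refl Bool
  time := timeBound
  outputsFun w := Classical.choice <| by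
    have hinit := (initList_machine (List.map id w)).trans
      (congrArg (config (some .read) {} · [] [] [] [] [] []) (List.map_id w))
    have h := reach_decide w
    rw [← hinit, ← haltList_machine] at h
    exact h

end LinearSetContainment

theorem theorem3p5 : LinearSetContainment.InP LinearSetContainment.unaryContainment := by
  refine ⟨LinearSetContainment.decisionProcedure, fun k => ?_⟩
  change Finite (LinearSetContainment.Alph k)
  cases k <;> dsimp only [LinearSetContainment.Alph] <;> infer_instance
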